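/- Let $d_A,d_B\ge 2$ be integers, $d=\min(d_A,d_B)$, let $l\ge 0$ be an integer and $\alpha,\beta\in\mathbb R$. For a complex matrix $A$ write $\|A\|_{tr}=\operatorname{tr}\sqrt{A^\dagger A}$, let $\operatorname{vec}(A)$ be the column vector obtained by stacking the columns of $A$, and let $\omega_l(A)=(\operatorname{vec}(A),\dots,\operatorname{vec}(A))$ ($l$ columns). Let $\rho$ be a state on $\mathbb C^{d_A}\otimes\mathbb C^{d_B}$, i.e. a positive semidefinite $d_Ad_B\times d_Ad_B$ matrix of trace one, regarded as a $d_A\times d_A$ block matrix with blocks $\rho_{i,j}\in\mathbb C^{d_B\times d_B}$. Let $\mathcal R(\rho)$ be the $d_A^2\times d_B^2$ matrix with rows $\operatorname{vec}(\rho_{1,1})^T,\dots,\operatorname{vec}(\rho_{d_A,1})^T,\dots,\operatorname{vec}(\rho_{1,d_A})^T,\dots,\operatorname{vec}(\rho_{d_A,d_A})^T$, let $E_{l\times l}$ be the $l\times l$ matrix all of whose entries are $1$, and put $$\mathcal M^l_{\alpha,\beta}(\rho)=\begin{pmatrix}\alpha\beta E_{l\times l} & \alpha\,\omega_l(\operatorname{tr}_A\rho)^T\\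 \beta\,\omega_l(\operatorname{tr}_B\rho) & \mathcal R(\rho)\end{pmatrix},$$ where $\operatorname{tr}_A,\operatorname{tr}_B$ are the partial traces over the first and the second factor. For a unit vector $|\varphi\rangle\in\mathbb C^{d_A}\otimes\mathbb C^{d_B}$ let $$\mathcal N(|\varphi\rangle)=\frac{\big\|(|\varphi\rangle\langle\varphi|)^{T_B}\big\|_{tr}-1}{d-1},$$ where $T_B$ is the partial transpose on the second factor, and let the convex-roof extended negativity of $\rho$ be $$\mathcal N(\rho)=\inf\sum_i p_i\,\mathcal N(|\varphi_i\rangle),$$ the infimum (which is a minimum) being over all finite decompositions $\rho=\sum_i p_i|\varphi_i\rangle\langle\varphi_i|$ with $p_i\ge 0$, $\sum_i p_i=1$ and unit vectors $|\varphi_i\rangle$. Then $$\mathcal N(\rho)\ \ge\ \frac{\big\|\mathcal M^l_{\alpha,\beta}(\rho)\big\|_{tr}-\sqrt{(l\alpha^2+1)(l\beta^2+1)}}{d-1}.$$ -/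

import Mathlib

open scoped Matrix

namespace CREN

noncomputable section

open scoped ComplexOrder MatrixOrder

/-- Trace norm `‖A‖_tr = tr √(A† A)` of a rectangular complex matrix. The trace is a nonnegative
real number; its real part is taken to land in `ℝ`. -/
def traceNorm {m n : Type*} [Fintype m] [Fintype n] [DecidableEq n] (A : Matrix m n ℂ) : ℝ :=
  (Matrix.trace (CFC.sqrt (Aᴴ * A))).re

/-- Matrices on `ℂ^dA ⊗ ℂ^dB`, in the product basis `|i⟩ ⊗ |k⟩ = (i, k)`. -/
abbrev BipMatrix (dA dB : ℕ) : Type := Matrix (Fin dA × Fin dB) (Fin dA × Fin dB) ℂ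

/-- Vectors of `ℂ^dA ⊗ ℂ^dB`, by their coordinates in the product basis. -/
abbrev BipVector (dA dB : ℕ) : Type := Fin dA × Fin dB → ℂ

/-- A state (density matrix): positive semidefinite with trace one. -/
structure IsState {dA dB : ℕ} (ρ : BipMatrix dA dB) : Prop where
  posSemidef : ρ.PosSemidef
  trace_eq_one : ρ.trace = 1

/-- A pure state vector: `⟨φ|φ⟩ = 1`. -/
def IsPure {dA dB : ℕ} (φ : BipVector dA dB) : Prop := star φ ⬝ᵥ φ = 1

/-- The operator `|φ⟩⟨φ|`. -/
def proj {dA dB : ℕ} (φ : BipVector dA dB) : BipMatrix dA dB := Matrix.vecMulVec φ (star φ)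

/-- Partial trace over the first subsystem. -/
def trA {dA dB : ℕ} (ρ : BipMatrix dA dB) : Matrix (Fin dB) (Fin dB) ℂ :=
  Matrix.of fun k k' => ∑ i, ρ (i, k) (i, k')

/-- Partial trace over the second subsystem. -/
def trB {dA dB : ℕ} (ρ : BipMatrix dA dB) : Matrix (Fin dA) (Fin dA) ℂ :=
  Matrix.of fun i i' => ∑ k, ρ (i, k) (i', k)

/-- Partial transpose with respect to the second subsystem. -/
def partialTransposeB {dA dB : ℕ} (ρ : BipMatrix dA dB) : BipMatrix dA dB :=
  Matrix.of fun x y => ρ (x.1, y.2) (y.1, x.2)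

/-- The block `Z_{i,j}` of a block matrix `Z`. -/
def block {dA dB : ℕ} (Z : BipMatrix dA dB) (i j : Fin dA) : Matrix (Fin dB) (Fin dB) ℂ :=
  Matrix.of fun k k' => Z (i, k) (j, k')

/-- The realigned matrix `R(Z)`: its rows are `vec(Z_{i,j})ᵀ`, ordered as the entries of
`vec`, i.e. the row of the block `Z_{i,j}` has the index `(j, i)`, as in `Matrix.vec`. -/
def realign {dA dB : ℕ} (Z : BipMatrix dA dB) :
    Matrix (Fin dA × Fin dA) (Fin dB × Fin dB) ℂ :=
  Matrix.of fun x => (block Z x.2 x.1).vec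

/-- `ω_l(X) = (vec X, …, vec X)`, with `l` columns. -/
def omega {n : ℕ} (l : ℕ) (X : Matrix (Fin n) (Fin n) ℂ) : Matrix (Fin n × Fin n) (Fin l) ℂ :=
  Matrix.replicateCol (Fin l) X.vec

/-- The block matrix `M^l_{α,β}(ρ)`, with blocks `αβ E`, `α ω_l(tr_A ρ)ᵀ`, `β ω_l(tr_B ρ)`
and `R(ρ)`, where `E` is the `l × l` matrix all of whose entries are `1`. -/
def realignM {dA dB : ℕ} (l : ℕ) (α β : ℝ) (ρ : BipMatrix dA dB) :
    Matrix (Fin l ⊕ Fin dA × Fin dA) (Fin l ⊕ Fin dB × Fin dB) ℂ :=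
  Matrix.fromBlocks
    (((α : ℂ) * (β : ℂ)) • Matrix.of fun _ _ => 1) ((α : ℂ) • (omega l (trA ρ))ᵀ)
    ((β : ℂ) • omega l (trB ρ)) (realign ρ)

/-- Negativity of a pure state vector: `(‖(|φ⟩⟨φ|)^{T_B}‖_tr - 1) / (d - 1)` with
`d = min dA dB`. -/
def pureNegativity {dA dB : ℕ} (φ : BipVector dA dB) : ℝ :=
  (traceNorm (partialTransposeB (proj φ)) - 1) / (((min dA dB : ℕ) : ℝ) - 1)

/-- `ρ = ∑ i, p i |φ i⟩⟨φ i|` is a decomposition of `ρ` into pure states. -/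
structure IsPureDecomposition {dA dB n : ℕ} (ρ : BipMatrix dA dB)
    (p : Fin n → ℝ) (φ : Fin n → BipVector dA dB) : Prop where
  nonneg : ∀ i, 0 ≤ p i
  sum_eq_one : ∑ i, p i = 1
  isPure : ∀ i, IsPure (φ i)
  eq_sum : ρ = ∑ i, (p i : ℂ) • proj (φ i)

/-- The average negativities of all pure state decompositions of `ρ`. -/
def averageNegativities {dA dB : ℕ} (ρ : BipMatrix dA dB) : Set ℝ :=
  {x | ∃ (n : ℕ) (p : Fin n → ℝ) (φ : Fin n → BipVector dA dB),
    IsPureDecomposition ρ p φ ∧ x = ∑ i, p i * pureNegativity (φ i)}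

/-- Convex-roof extended negativity: the infimum of the average negativity over all pure state
decompositions. -/
def cren {dA dB : ℕ} (ρ : BipMatrix dA dB) : ℝ := sInf (averageNegativities ρ)

end

end CREN

open scoped ComplexOrder MatrixOrder

/-! A singular value decomposition of the coefficient matrix of a unit vector `φ` is its Schmidt
decomposition, with coefficients `s i` satisfying `∑ s i ^ 2 = 1`. It writes `realignM` of `proj φ`
as a sum over pairs `(i, j)` of rank-one terms `s i * s j * a bᵀ`. The two vectors have norm 1 if `i
≠ j`; if `i = j` their norms multiply to `K = √((l α² + 1)(l β² + 1))`. The triangle inequality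
bounds the trace norm by `(∑ s i)² - 1 + K`, and `(∑ s i)²` is exactly the trace norm of the partial
transpose (`traceNorm_realignM_proj_le`).

For a mixed state, `realignM` is affine (`realignM_sum_smul`) and the trace norm is convex
(`traceNorm_sum_smul_le`), so the bound passes to every pure state decomposition and hence to the
infimum. -/

namespace CREN

/-! ### Singular value decomposition and the trace norm. -/

section SingularValues

variable {m n ι κ : Type*} [Fintype m] [Fintype n] [Fintype ι] [Fintype κ]


/-- `A = U diag(s) V†` with isometries `U`, `V` and nonnegative singular values `s`. -/
structure IsSVD [DecidableEq ι] (A : Matrix m n ℂ) (s : ι → ℝ) (U : Matrix m ι ℂ) (V : Matrix n ι ℂ) : Prop where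
  nonneg : ∀ i, 0 ≤ s i
  left_isometry : Uᴴ * U = 1
  right_isometry : Vᴴ * V = 1
  eq_mul : A = U * Matrix.diagonal (fun i => (s i : ℂ)) * Vᴴ

theorem IsSVD.apply [DecidableEq ι] {A : Matrix m n ℂ} {s : ι → ℝ} {U : Matrix m ι ℂ} {V : Matrix n ι ℂ}
    (h : IsSVD A s U V) (x : m) (y : n) : A x y = ∑ i, s i * U x i * star (V y i) := by
  rw [h.eq_mul, Matrix.mul_apply]
  simp [Matrix.mul_diagonal, mul_comm]

omit [Fintype ι] in
theorem sum_star_mul_of_isometry [DecidableEq ι] {U : Matrix m ι ℂ} (h : Uᴴ * U = 1) (i j : ι) :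
    ∑ x, star (U x i) * U x j = if i = j then 1 else 0 := by
  have := congrFun (congrFun h i) j
  simpa [Matrix.mul_apply, Matrix.one_apply] using this

omit [Fintype ι] in
theorem sum_sq_norm_eq_one_of_isometry [DecidableEq ι] {U : Matrix m ι ℂ} (h : Uᴴ * U = 1) (i : ι) :
    ∑ x, ‖U x i‖ ^ 2 = 1 := by
  have := sum_star_mul_of_isometry h i i
  simp only [if_true, Complex.star_def, Complex.conj_mul'] at this
  exact_mod_cast this

/-- Diagonalise `Aᴴ * A` by a unitary `W`: the columns of `A * W` are orthogonal with squared norms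
the eigenvalues. Keeping only nonzero eigenvalues allows these columns to be normalised and gives
isometries without completing a basis. -/
theorem exists_isSVD [DecidableEq n] (A : Matrix m n ℂ) :
    ∃ (p : n → Prop) (_ : Fintype {i // p i}) (s : {i // p i} → ℝ)
      (U : Matrix m {i // p i} ℂ) (V : Matrix n {i // p i} ℂ), IsSVD A s U V := by
  classical
  have hH : (Aᴴ * A).PosSemidef := Matrix.posSemidef_conjTranspose_mul_self A
  set ev := hH.isHermitian.eigenvalues with hev
  have hev0 : ∀ i, 0 ≤ ev i := hH.eigenvalues_nonneg
  set W : Matrix n n ℂ := (hH.isHermitian.eigenvectorUnitary).1 with hW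
  have hWl : Wᴴ * W = 1 := Unitary.coe_star_mul_self hH.isHermitian.eigenvectorUnitary
  have hWr : W * Wᴴ = 1 := Unitary.coe_mul_star_self hH.isHermitian.eigenvectorUnitary
  have hdiag : (A * W)ᴴ * (A * W) = Matrix.diagonal (fun i => (ev i : ℂ)) := by
    have := hH.isHermitian.conjStarAlgAut_star_eigenvectorUnitary
    rw [Unitary.conjStarAlgAut_star_apply] at this
    rw [Matrix.conjTranspose_mul, Matrix.mul_assoc, ← Matrix.mul_assoc Aᴴ, ← Matrix.mul_assoc]
    exact this
  have hentry : ∀ i j, ∑ x, star ((A * W) x i) * (A * W) x j = if i = j then (ev i : ℂ) else 0 := by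
    intro i j
    have := congrFun (congrFun hdiag i) j
    simpa only [Matrix.mul_apply (M := (A * W)ᴴ), Matrix.conjTranspose_apply,
      Matrix.diagonal_apply] using this
  -- The discarded columns vanish, so nothing is lost when `A * W * Wᴴ` is restricted to the kept
  -- indices.
  have hzero : ∀ i, ev i = 0 → ∀ x, (A * W) x i = 0 := by
    intro i hi x
    have h := hentry i i
    simp only [if_true, hi, Complex.star_def, Complex.conj_mul'] at h
    have h' : ∑ x, ‖(A * W) x i‖ ^ 2 = 0 := by exact_mod_cast h
    rw [Finset.sum_eq_zero_iff_of_nonneg (fun _ _ => by positivity)] at h'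
    simpa using h' x (Finset.mem_univ x)
  have hpos : ∀ i : {i // ev i ≠ 0}, (0 : ℝ) < √(ev i) := fun i =>
    Real.sqrt_pos.2 (lt_of_le_of_ne (hev0 i) (Ne.symm i.2))
  refine ⟨fun i => ev i ≠ 0, inferInstance, fun i => √(ev i),
    Matrix.of fun x i => (A * W) x i / (√(ev i) : ℂ), W.submatrix id Subtype.val,
    fun i => Real.sqrt_nonneg _, ?_, ?_, ?_⟩
  · ext i j
    have h := hentry i j
    have hi : ((√(ev i) : ℝ) : ℂ) ≠ 0 := by exact_mod_cast (hpos i).ne'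
    have hsq : ((√(ev i) : ℝ) : ℂ) * (√(ev i) : ℝ) = ev i := by
      exact_mod_cast Real.mul_self_sqrt (hev0 i)
    simp only [Matrix.mul_apply (M := (Matrix.of _)ᴴ), Matrix.conjTranspose_apply, Matrix.of_apply,
      star_div₀, div_mul_div_comm, ← Finset.sum_div, h, Matrix.one_apply, Subtype.ext_iff]
    split_ifs with hij
    · rw [← hij, Complex.star_def, Complex.conj_ofReal, hsq, div_self]
      exact_mod_cast i.2
    · simp
  · ext i j
    have h := sum_star_mul_of_isometry hWl i.1 j.1
    simpa [Matrix.mul_apply, Matrix.one_apply, Subtype.ext_iff] using h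
  · have hA : A = A * W * Wᴴ := by rw [Matrix.mul_assoc, hWr, Matrix.mul_one]
    ext x y
    rw [Matrix.mul_apply]
    conv_lhs => rw [hA, Matrix.mul_apply]
    have hsub : ∑ i, (A * W) x i * Wᴴ i y
        = ∑ i : {i // ev i ≠ 0}, (A * W) x i.1 * Wᴴ i.1 y := by
      rw [← Finset.sum_subtype (Finset.univ.filter fun i => ev i ≠ 0) (by simp)
        (fun i => (A * W) x i * Wᴴ i y)]
      exact (Finset.sum_filter_of_ne (p := fun i => ev i ≠ 0) fun i _ hne hi =>
        hne (by rw [hzero i hi x, zero_mul])).symm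
    rw [hsub]
    refine Finset.sum_congr rfl fun i _ => ?_
    have hi : ((√(ev i) : ℝ) : ℂ) ≠ 0 := by exact_mod_cast (hpos i).ne'
    simp only [Matrix.mul_diagonal, Matrix.of_apply, Matrix.conjTranspose_apply,
      Matrix.submatrix_apply, id, div_mul_cancel₀ _ hi]

theorem posSemidef_conj_diagonal [DecidableEq ι] (V : Matrix n ι ℂ) {s : ι → ℝ} (hs : ∀ i, 0 ≤ s i) :
    (V * Matrix.diagonal (fun i => (s i : ℂ)) * Vᴴ).PosSemidef := by
  refine Matrix.PosSemidef.mul_mul_conjTranspose_same (Matrix.PosSemidef.diagonal ?_) V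
  exact fun i => Complex.zero_le_real.2 (hs i)

/-- The trace norm is the sum of the singular values. -/
theorem IsSVD.traceNorm_eq [DecidableEq n] [DecidableEq ι] {A : Matrix m n ℂ} {s : ι → ℝ} {U : Matrix m ι ℂ} {V : Matrix n ι ℂ}
    (h : IsSVD A s U V) : traceNorm A = ∑ i, s i := by
  have hsqrt : CFC.sqrt (Aᴴ * A) = V * Matrix.diagonal (fun i => (s i : ℂ)) * Vᴴ := by
    refine CFC.sqrt_unique ?_ (posSemidef_conj_diagonal V h.nonneg).nonneg
    have hd : (Matrix.diagonal (fun i => (s i : ℂ)))ᴴ = Matrix.diagonal (fun i => (s i : ℂ)) := by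
      rw [Matrix.diagonal_conjTranspose]
      congr 1
      ext i
      simp
    rw [h.eq_mul]
    simp only [Matrix.conjTranspose_mul, Matrix.conjTranspose_conjTranspose, hd, Matrix.mul_assoc]
    rw [← Matrix.mul_assoc Vᴴ V, h.right_isometry, ← Matrix.mul_assoc Uᴴ U, h.left_isometry]
  rw [traceNorm, hsqrt, Matrix.trace_mul_comm, ← Matrix.mul_assoc, h.right_isometry,
    Matrix.one_mul, Matrix.trace_diagonal]
  simp

theorem sum_sq_norm_eq_re (a : ι → ℂ) : ∑ i, ‖a i‖ ^ 2 = (star a ⬝ᵥ a).re := by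
  simp [dotProduct, Complex.conj_mul', ← Complex.ofReal_pow]

/-- Bessel's inequality for the columns of an isometry. -/
theorem sum_sq_norm_conjTranspose_mulVec_le [DecidableEq ι] {U : Matrix m ι ℂ} (h : Uᴴ * U = 1) (a : m → ℂ) :
    ∑ i, ‖(Uᴴ *ᵥ a) i‖ ^ 2 ≤ ∑ x, ‖a x‖ ^ 2 := by
  -- Pythagoras for the residual of the projection `U * Uᴴ`; its squared norm is nonnegative.
  have key : star (a - U *ᵥ (Uᴴ *ᵥ a)) ⬝ᵥ (a - U *ᵥ (Uᴴ *ᵥ a))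
      = star a ⬝ᵥ a - star (Uᴴ *ᵥ a) ⬝ᵥ (Uᴴ *ᵥ a) := by
    have h1 : star (Uᴴ *ᵥ a) ⬝ᵥ (Uᴴ *ᵥ a) = star a ⬝ᵥ (U *ᵥ (Uᴴ *ᵥ a)) := by
      rw [Matrix.star_mulVec, Matrix.conjTranspose_conjTranspose, ← Matrix.dotProduct_mulVec]
    have h2 : star (U *ᵥ (Uᴴ *ᵥ a)) ⬝ᵥ a = star (Uᴴ *ᵥ a) ⬝ᵥ (Uᴴ *ᵥ a) := by
      rw [Matrix.star_mulVec, ← Matrix.dotProduct_mulVec]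
    have h3 : star (U *ᵥ (Uᴴ *ᵥ a)) ⬝ᵥ (U *ᵥ (Uᴴ *ᵥ a)) = star (Uᴴ *ᵥ a) ⬝ᵥ (Uᴴ *ᵥ a) := by
      rw [Matrix.star_mulVec, ← Matrix.dotProduct_mulVec, Matrix.mulVec_mulVec _ Uᴴ U, h,
        Matrix.one_mulVec]
    rw [star_sub, sub_dotProduct, dotProduct_sub, dotProduct_sub, h2, h3, ← h1]
    ring
  have := sum_sq_norm_eq_re (a - U *ᵥ (Uᴴ *ᵥ a))
  rw [key, Complex.sub_re, ← sum_sq_norm_eq_re, ← sum_sq_norm_eq_re] at this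
  have h0 : 0 ≤ ∑ i, ‖(a - U *ᵥ (Uᴴ *ᵥ a)) i‖ ^ 2 := Finset.sum_nonneg fun _ _ => by positivity
  linarith

/-- A sum of rank-one matrices `a bᵀ` has trace norm at most `∑ c ‖a‖ ‖b‖`. -/
theorem traceNorm_le_of_eq_sum [DecidableEq n] {A : Matrix m n ℂ} {c : κ → ℝ} (hc : ∀ k, 0 ≤ c k)
    {a : κ → m → ℂ} {b : κ → n → ℂ} (hA : ∀ x y, A x y = ∑ k, c k * a k x * b k y) :
    traceNorm A ≤ ∑ k, c k * (√(∑ x, ‖a k x‖ ^ 2) * √(∑ y, ‖b k y‖ ^ 2)) := by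
  obtain ⟨p, _, s, U, V, h⟩ := exists_isSVD A
  classical
  -- Each singular value is a diagonal entry of `Uᴴ * A * V`. Summed over `i`, each rank-one term is
  -- then controlled by Cauchy–Schwarz and Bessel.
  have hs : ∀ i, (s i : ℂ) = ∑ k, c k * ((Uᴴ *ᵥ a k) i * (b k ᵥ* V) i) := by
    intro i
    have h1 : Uᴴ * A * V = Matrix.diagonal (fun i => (s i : ℂ)) := by
      rw [h.eq_mul]
      simp only [← Matrix.mul_assoc]
      rw [h.left_isometry, Matrix.one_mul, Matrix.mul_assoc, h.right_isometry, Matrix.mul_one]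
    have h2 : A = ∑ k, (c k : ℂ) • Matrix.vecMulVec (a k) (b k) := by
      ext x y
      simp [hA, Matrix.sum_apply, Matrix.vecMulVec_apply, mul_assoc]
    have h3 := congrFun (congrFun h1 i) i
    rw [Matrix.diagonal_apply_eq, h2] at h3
    rw [← h3]
    simp [Matrix.mul_sum, Matrix.sum_mul, Matrix.sum_apply, Matrix.mul_vecMulVec,
      Matrix.vecMulVec_mul, Matrix.vecMulVec_apply]
  have hb : ∀ k, ∑ i, ‖(b k ᵥ* V) i‖ ^ 2 ≤ ∑ y, ‖b k y‖ ^ 2 := by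
    intro k
    have := sum_sq_norm_conjTranspose_mulVec_le h.right_isometry (star (b k))
    have e : Vᴴ *ᵥ star (b k) = star (b k ᵥ* V) := (Matrix.star_vecMul V (b k)).symm
    simpa [e] using this
  calc traceNorm A = ∑ i, s i := h.traceNorm_eq
    _ ≤ ∑ i, ∑ k, c k * (‖(Uᴴ *ᵥ a k) i‖ * ‖(b k ᵥ* V) i‖) := by
      refine Finset.sum_le_sum fun i _ => ?_
      have h1 : s i = ‖(s i : ℂ)‖ := by simp [abs_of_nonneg (h.nonneg i)]
      rw [h1, hs i]
      refine (norm_sum_le _ _).trans (Finset.sum_le_sum fun k _ => ?_)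
      rw [norm_mul, norm_mul, Complex.norm_real, Real.norm_of_nonneg (hc k)]
    _ = ∑ k, c k * ∑ i, ‖(Uᴴ *ᵥ a k) i‖ * ‖(b k ᵥ* V) i‖ := by
      rw [Finset.sum_comm]
      simp only [Finset.mul_sum]
    _ ≤ _ := by
      refine Finset.sum_le_sum fun k _ => mul_le_mul_of_nonneg_left ?_ (hc k)
      refine (Real.sum_mul_le_sqrt_mul_sqrt _ _ _).trans ?_
      gcongr
      · exact sum_sq_norm_conjTranspose_mulVec_le h.left_isometry (a k)
      · exact hb k

/-- Convexity of the trace norm. -/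
theorem traceNorm_sum_smul_le [DecidableEq n] {A : κ → Matrix m n ℂ} {c : κ → ℝ} (hc : ∀ k, 0 ≤ c k) :
    traceNorm (∑ k, (c k : ℂ) • A k) ≤ ∑ k, c k * traceNorm (A k) := by
  choose p _ s U V h using fun k => exists_isSVD (A k)
  classical
  -- Expanding every `A k` in its singular vectors gives rank-one terms with unit vectors and
  -- weights `c k * s k i`.
  have key := traceNorm_le_of_eq_sum (A := ∑ k, (c k : ℂ) • A k)
    (κ := Σ k, {i // p k i}) (c := fun z => c z.1 * s z.1 z.2)
    (fun z => mul_nonneg (hc _) ((h z.1).nonneg z.2))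
    (a := fun z x => U z.1 x z.2) (b := fun z y => star (V z.1 y z.2)) (by
      intro x y
      rw [Fintype.sum_sigma, Matrix.sum_apply]
      refine Finset.sum_congr rfl fun k _ => ?_
      rw [Matrix.smul_apply, (h k).apply, smul_eq_mul, Finset.mul_sum]
      refine Finset.sum_congr rfl fun i _ => ?_
      push_cast
      ring)
  refine key.trans (le_of_eq ?_)
  rw [Fintype.sum_sigma]
  refine Finset.sum_congr rfl fun k _ => ?_
  rw [(h k).traceNorm_eq, Finset.mul_sum]
  refine Finset.sum_congr rfl fun i _ => ?_
  simp only [norm_star, sum_sq_norm_eq_one_of_isometry (h k).left_isometry,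
    sum_sq_norm_eq_one_of_isometry (h k).right_isometry]
  simp

end SingularValues

/-! ### Pure states through the Schmidt decomposition. -/

section Pure

variable {dA dB : ℕ} {ι : Type*} [Fintype ι] [DecidableEq ι]

theorem proj_apply (φ : BipVector dA dB) (x y : Fin dA × Fin dB) :
    proj φ x y = φ x * star (φ y) := rfl

/-- Partial transposition exchanges the second-factor Schmidt vectors of the two sides. The result
is again a singular value decomposition, with left vectors indexed by `(i, j)`, right vectors by the
swapped pair, and singular values `s i * s j`. -/
theorem traceNorm_partialTransposeB_proj {φ : BipVector dA dB} {s : ι → ℝ}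
    {U : Matrix (Fin dA) ι ℂ} {V : Matrix (Fin dB) ι ℂ}
    (h : IsSVD (Matrix.of fun i k => φ (i, k)) s U V) :
    traceNorm (partialTransposeB (proj φ)) = (∑ i, s i) ^ 2 := by
  have hφ : ∀ x, φ x = ∑ i, s i * U x.1 i * star (V x.2 i) := fun x => h.apply x.1 x.2
  have hs : IsSVD (partialTransposeB (proj φ)) (fun z : ι × ι => s z.1 * s z.2)
      (Matrix.of fun x z => U x.1 z.1 * V x.2 z.2)
      (Matrix.of fun x z => U x.1 z.2 * V x.2 z.1) := by
    refine ⟨fun z => mul_nonneg (h.nonneg _) (h.nonneg _), ?_, ?_, ?_⟩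
    · ext z w
      have h1 := sum_star_mul_of_isometry h.left_isometry z.1 w.1
      have h2 := sum_star_mul_of_isometry h.right_isometry z.2 w.2
      simp only [Matrix.mul_apply, Matrix.conjTranspose_apply, Matrix.of_apply,
        Fintype.sum_prod_type, star_mul', mul_mul_mul_comm, ← Finset.mul_sum, ← Finset.sum_mul,
        h1, h2, Matrix.one_apply, Prod.ext_iff]
      split_ifs <;> simp_all
    · ext z w
      have h1 := sum_star_mul_of_isometry h.left_isometry z.2 w.2
      have h2 := sum_star_mul_of_isometry h.right_isometry z.1 w.1
      simp only [Matrix.mul_apply, Matrix.conjTranspose_apply, Matrix.of_apply,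
        Fintype.sum_prod_type, star_mul', mul_mul_mul_comm, ← Finset.mul_sum, ← Finset.sum_mul,
        h1, h2, Matrix.one_apply, Prod.ext_iff]
      split_ifs <;> simp_all
    · ext x y
      rw [Matrix.mul_apply]
      simp only [partialTransposeB, proj_apply, hφ, Matrix.of_apply, Matrix.mul_diagonal,
        Matrix.conjTranspose_apply, star_sum, star_mul', star_star, Finset.sum_mul_sum,
        Fintype.sum_prod_type]
      refine Finset.sum_congr rfl fun i _ => Finset.sum_congr rfl fun j _ => ?_
      simp only [Complex.star_def, Complex.conj_ofReal, Complex.ofReal_mul]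
      ring
  rw [hs.traceNorm_eq, Fintype.sum_prod_type, sq, Finset.sum_mul_sum]

/-- Orthonormality of the columns of `U` kills the cross terms. -/
theorem trA_proj {φ : BipVector dA dB} {s : ι → ℝ}
    {U : Matrix (Fin dA) ι ℂ} {V : Matrix (Fin dB) ι ℂ}
    (h : IsSVD (Matrix.of fun i k => φ (i, k)) s U V) (k k' : Fin dB) :
    trA (proj φ) k k' = ∑ i, s i * s i * (star (V k i) * V k' i) := by
  have hφ : ∀ x, φ x = ∑ i, s i * U x.1 i * star (V x.2 i) := fun x => h.apply x.1 x.2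
  have hU := sum_star_mul_of_isometry h.left_isometry
  calc trA (proj φ) k k'
      = ∑ x, ∑ i, ∑ j, (s i * star (V k i) * (s j * V k' j)) * (star (U x j) * U x i) := by
        simp only [trA, proj_apply, hφ, Matrix.of_apply, star_sum, Finset.sum_mul_sum, star_mul',
          Complex.star_def, Complex.conj_ofReal, Complex.conj_conj]
        refine Finset.sum_congr rfl fun x _ => Finset.sum_congr rfl fun i _ =>
          Finset.sum_congr rfl fun j _ => ?_
        ring
    _ = ∑ i, ∑ j, (s i * star (V k i) * (s j * V k' j)) * ∑ x, star (U x j) * U x i := by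
        rw [Finset.sum_comm]
        refine Finset.sum_congr rfl fun i _ => ?_
        rw [Finset.sum_comm]
        simp only [Finset.mul_sum]
    _ = _ := by
        simp only [hU, mul_ite, mul_one, mul_zero, Finset.sum_ite_eq', Finset.mem_univ, if_true]
        refine Finset.sum_congr rfl fun i _ => ?_
        ring

theorem trB_proj {φ : BipVector dA dB} {s : ι → ℝ}
    {U : Matrix (Fin dA) ι ℂ} {V : Matrix (Fin dB) ι ℂ}
    (h : IsSVD (Matrix.of fun i k => φ (i, k)) s U V) (k k' : Fin dA) :
    trB (proj φ) k k' = ∑ i, s i * s i * (U k i * star (U k' i)) := by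
  have hφ : ∀ x, φ x = ∑ i, s i * U x.1 i * star (V x.2 i) := fun x => h.apply x.1 x.2
  have hV := sum_star_mul_of_isometry h.right_isometry
  calc trB (proj φ) k k'
      = ∑ x, ∑ i, ∑ j, (s i * U k i * (s j * star (U k' j))) * (star (V x i) * V x j) := by
        simp only [trB, proj_apply, hφ, Matrix.of_apply, star_sum, Finset.sum_mul_sum, star_mul',
          Complex.star_def, Complex.conj_ofReal, Complex.conj_conj]
        refine Finset.sum_congr rfl fun x _ => Finset.sum_congr rfl fun i _ =>
          Finset.sum_congr rfl fun j _ => ?_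
        ring
    _ = ∑ i, ∑ j, (s i * U k i * (s j * star (U k' j))) * ∑ x, star (V x i) * V x j := by
        rw [Finset.sum_comm]
        refine Finset.sum_congr rfl fun i _ => ?_
        rw [Finset.sum_comm]
        simp only [Finset.mul_sum]
    _ = _ := by
        simp only [hV, mul_ite, mul_one, mul_zero, Finset.sum_ite_eq, Finset.mem_univ, if_true]
        refine Finset.sum_congr rfl fun i _ => ?_
        ring

theorem trace_trA (ρ : BipMatrix dA dB) : (trA ρ).trace = ρ.trace := by
  simp only [Matrix.trace, trA, Matrix.diag_apply, Matrix.of_apply, Fintype.sum_prod_type]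
  exact Finset.sum_comm

theorem trace_proj (φ : BipVector dA dB) : (proj φ).trace = star φ ⬝ᵥ φ := by
  rw [proj, Matrix.trace_vecMulVec, dotProduct_comm]

theorem sum_sq_eq_one_of_isPure {φ : BipVector dA dB} (hφ : IsPure φ) {s : ι → ℝ}
    {U : Matrix (Fin dA) ι ℂ} {V : Matrix (Fin dB) ι ℂ}
    (h : IsSVD (Matrix.of fun i k => φ (i, k)) s U V) : ∑ i, s i * s i = 1 := by
  have h1 : (trA (proj φ)).trace = 1 := by rw [trace_trA, trace_proj, hφ]
  have h2 : (trA (proj φ)).trace = ∑ i, (s i : ℂ) * s i := by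
    simp only [Matrix.trace, Matrix.diag_apply, trA_proj h]
    rw [Finset.sum_comm]
    simp only [← Finset.mul_sum, sum_star_mul_of_isometry h.right_isometry, if_true, mul_one]
  rw [h1] at h2
  exact_mod_cast h2.symm

/-- Norms of the vectors in the rank-one expansion: only diagonal pairs carry the `l` extra entries
`α`. -/
theorem sum_ite_sq_norm {l : ℕ} {κ ι' : Type*} [Fintype κ] [DecidableEq ι'] (α : ℝ) (i j : ι')
    (a : κ → ℂ) (ha : ∑ x, ‖a x‖ ^ 2 = 1) :
    ∑ x, ‖(Sum.elim (fun _ => if i = j then (α : ℂ) else 0) a : Fin l ⊕ κ → ℂ) x‖ ^ 2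
      = if i = j then l * α ^ 2 + 1 else 1 := by
  rw [Fintype.sum_sum_type]
  split_ifs <;> simp [ha]

theorem sum_sq_norm_mul {κ κ' : Type*} [Fintype κ] [Fintype κ'] {a : κ → ℂ} {b : κ' → ℂ}
    (ha : ∑ x, ‖a x‖ ^ 2 = 1) (hb : ∑ x, ‖b x‖ ^ 2 = 1) :
    ∑ x : κ × κ', ‖a x.1 * b x.2‖ ^ 2 = 1 := by
  simp only [norm_mul, mul_pow, Fintype.sum_prod_type, ← Finset.mul_sum, ha, hb, mul_one]

/-- Rank-one expansion of `M^l_{α,β}(|φ⟩⟨φ|)` given by the Schmidt decomposition of `φ`. -/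
theorem realignM_proj_apply (l : ℕ) (α β : ℝ) {φ : BipVector dA dB} (hφ : IsPure φ) {s : ι → ℝ}
    {U : Matrix (Fin dA) ι ℂ} {V : Matrix (Fin dB) ι ℂ}
    (h : IsSVD (Matrix.of fun i k => φ (i, k)) s U V)
    (x : Fin l ⊕ Fin dA × Fin dA) (y : Fin l ⊕ Fin dB × Fin dB) :
    realignM l α β (proj φ) x y = ∑ z : ι × ι, ((s z.1 * s z.2 : ℝ) : ℂ) *
      Sum.elim (fun _ => if z.1 = z.2 then (α : ℂ) else 0)
        (fun x => star (U x.1 z.2) * U x.2 z.1) x *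
      Sum.elim (fun _ => if z.1 = z.2 then (β : ℂ) else 0)
        (fun y => V y.1 z.2 * star (V y.2 z.1)) y := by
  have happ : ∀ x, φ x = ∑ i, s i * U x.1 i * star (V x.2 i) := fun x => h.apply x.1 x.2
  have hs : ∑ i, (s i : ℂ) * s i = 1 := by exact_mod_cast sum_sq_eq_one_of_isPure hφ h
  rcases x with x | x <;> rcases y with y | y
  -- The corner `α β E` is recovered from the diagonal pairs because the squared Schmidt
  -- coefficients sum to 1.
  · simp [realignM, Fintype.sum_prod_type, ← Finset.sum_mul, hs]
  · simp only [realignM, omega, Matrix.fromBlocks_apply₁₂, Matrix.smul_apply,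
      Matrix.transpose_apply, Matrix.replicateCol_apply, Matrix.vec, trA_proj h, smul_eq_mul,
      Finset.mul_sum, Fintype.sum_prod_type, Sum.elim_inl, Sum.elim_inr, mul_ite, ite_mul,
      mul_zero, zero_mul, Finset.sum_ite_eq, Finset.mem_univ, if_true, Complex.ofReal_mul]
    refine Finset.sum_congr rfl fun i _ => ?_
    ring
  · simp only [realignM, omega, Matrix.fromBlocks_apply₂₁, Matrix.smul_apply,
      Matrix.replicateCol_apply, Matrix.vec, trB_proj h, smul_eq_mul,
      Finset.mul_sum, Fintype.sum_prod_type, Sum.elim_inl, Sum.elim_inr, mul_ite,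
      mul_zero, Finset.sum_ite_eq, Finset.mem_univ, if_true, Complex.ofReal_mul]
    refine Finset.sum_congr rfl fun i _ => ?_
    ring
  · simp only [realignM, realign, block, Matrix.vec, Matrix.fromBlocks_apply₂₂,
      Matrix.of_apply, proj_apply, happ, Sum.elim_inr, star_sum, star_mul',
      Finset.sum_mul_sum, Fintype.sum_prod_type, Complex.star_def, Complex.conj_ofReal,
      Complex.conj_conj, Complex.ofReal_mul]
    refine Finset.sum_congr rfl fun i _ => Finset.sum_congr rfl fun j _ => ?_
    ring

theorem traceNorm_realignM_proj_le (l : ℕ) (α β : ℝ) {φ : BipVector dA dB} (hφ : IsPure φ) :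
    traceNorm (realignM l α β (proj φ)) ≤ traceNorm (partialTransposeB (proj φ)) - 1
      + √((l * α ^ 2 + 1) * (l * β ^ 2 + 1)) := by
  classical
  obtain ⟨p, _, s, U, V, h⟩ := exists_isSVD (Matrix.of fun i k => φ (i, k))
  have hs := sum_sq_eq_one_of_isPure hφ h
  have nU := sum_sq_norm_eq_one_of_isometry h.left_isometry
  have nV := sum_sq_norm_eq_one_of_isometry h.right_isometry
  have nU' : ∀ i, ∑ x, ‖star (U x i)‖ ^ 2 = 1 := by simpa only [norm_star] using nU
  have nV' : ∀ i, ∑ x, ‖star (V x i)‖ ^ 2 = 1 := by simpa only [norm_star] using nV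
  refine (traceNorm_le_of_eq_sum (fun z => mul_nonneg (h.nonneg _) (h.nonneg _))
    (realignM_proj_apply l α β hφ h)).trans (le_of_eq ?_)
  set K := √((l * α ^ 2 + 1) * (l * β ^ 2 + 1)) with hK
  -- Splitting off 1 from every pair makes the full sum `(∑ s i)²`; the excess `K - 1` on the
  -- diagonal is weighted by `∑ s i ^ 2 = 1`.
  have hterm : ∀ z : {i // p i} × {i // p i},
      √(if z.1 = z.2 then l * α ^ 2 + 1 else 1) * √(if z.1 = z.2 then l * β ^ 2 + 1 else 1)
        = 1 + if z.1 = z.2 then K - 1 else 0 := by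
    intro z
    split_ifs
    · rw [← Real.sqrt_mul (by positivity), ← hK]
      ring
    · simp
  calc _ = ∑ z : {i // p i} × {i // p i},
        (s z.1 * s z.2 + if z.1 = z.2 then s z.1 * s z.2 * (K - 1) else 0) := by
        refine Finset.sum_congr rfl fun z _ => ?_
        rw [sum_ite_sq_norm α z.1 z.2 _ (sum_sq_norm_mul (nU' z.2) (nU z.1)),
          sum_ite_sq_norm β z.1 z.2 _ (sum_sq_norm_mul (nV z.2) (nV' z.1)), hterm, mul_add,
          mul_one, mul_ite, mul_zero]
    _ = _ := by
        rw [Finset.sum_add_distrib, traceNorm_partialTransposeB_proj h, Fintype.sum_prod_type,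
          Fintype.sum_prod_type, sq, Finset.sum_mul_sum]
        simp only [Finset.sum_ite_eq, Finset.mem_univ, if_true, ← Finset.sum_mul, hs]
        ring

end Pure

/-! ### Convex combinations and passage to mixed states. -/

section Mixed

variable {dA dB : ℕ}

/-- Three blocks are linear in the state, but the corner is constant; the weights must sum to 1 for
it to be preserved. -/
theorem realignM_sum_smul (l : ℕ) (α β : ℝ) {n : ℕ} {p : Fin n → ℝ} (hp : ∑ i, p i = 1)
    (Z : Fin n → BipMatrix dA dB) :
    realignM l α β (∑ i, (p i : ℂ) • Z i) = ∑ i, (p i : ℂ) • realignM l α β (Z i) := by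
  have hp' : ∑ i, (p i : ℂ) = 1 := by exact_mod_cast hp
  ext (x | x) (y | y)
  · simp [realignM, Matrix.sum_apply, ← Finset.sum_mul, hp']
  · simp only [realignM, omega, Matrix.sum_apply, Matrix.smul_apply, Matrix.fromBlocks_apply₁₂,
      Matrix.transpose_apply, Matrix.replicateCol_apply, Matrix.vec, trA, Matrix.of_apply,
      smul_eq_mul, Finset.mul_sum]
    rw [Finset.sum_comm]
    refine Finset.sum_congr rfl fun i _ => Finset.sum_congr rfl fun j _ => ?_
    ring
  · simp only [realignM, omega, Matrix.sum_apply, Matrix.smul_apply, Matrix.fromBlocks_apply₂₁,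
      Matrix.replicateCol_apply, Matrix.vec, trB, Matrix.of_apply,
      smul_eq_mul, Finset.mul_sum]
    rw [Finset.sum_comm]
    refine Finset.sum_congr rfl fun i _ => Finset.sum_congr rfl fun j _ => ?_
    ring
  · simp only [realignM, realign, block, Matrix.vec, Matrix.sum_apply, Matrix.smul_apply,
      Matrix.fromBlocks_apply₂₂, Matrix.of_apply]

theorem traceNorm_realignM_le {l : ℕ} {α β : ℝ} {ρ : BipMatrix dA dB} {n : ℕ} {p : Fin n → ℝ}
    {φ : Fin n → BipVector dA dB} (h : IsPureDecomposition ρ p φ) :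
    traceNorm (realignM l α β ρ) - √((l * α ^ 2 + 1) * (l * β ^ 2 + 1)) ≤
      ∑ i, p i * (traceNorm (partialTransposeB (proj (φ i))) - 1) := by
  set K := √((l * α ^ 2 + 1) * (l * β ^ 2 + 1))
  have h1 : traceNorm (realignM l α β ρ) ≤
      ∑ i, p i * (traceNorm (partialTransposeB (proj (φ i))) - 1 + K) := by
    rw [h.eq_sum, realignM_sum_smul l α β h.sum_eq_one]
    refine (traceNorm_sum_smul_le h.nonneg).trans (Finset.sum_le_sum fun i _ => ?_)
    exact mul_le_mul_of_nonneg_left (traceNorm_realignM_proj_le l α β (h.isPure i)) (h.nonneg i)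
  simp only [mul_add _ _ K, Finset.sum_add_distrib, ← Finset.sum_mul, h.sum_eq_one] at h1
  linarith

/-- Needed because the real `sInf` of the empty set is 0, which would make a lower bound on `cren`
meaningless. The spectral decomposition of `ρ` supplies an element. -/
theorem averageNegativities_nonempty {ρ : BipMatrix dA dB} (hρ : IsState ρ) :
    (averageNegativities ρ).Nonempty := by
  set H := hρ.posSemidef.isHermitian with hH
  set W : BipMatrix dA dB := (H.eigenvectorUnitary).1 with hW
  have hWl : Wᴴ * W = 1 := Unitary.coe_star_mul_self H.eigenvectorUnitary
  let e : Fin (dA * dB) ≃ Fin dA × Fin dB := finProdFinEquiv.symm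
  refine ⟨_, dA * dB, fun i => H.eigenvalues (e i), fun i x => W x (e i), ⟨?_, ?_, ?_, ?_⟩, rfl⟩
  · exact fun i => hρ.posSemidef.eigenvalues_nonneg _
  · have := H.trace_eq_sum_eigenvalues
    rw [hρ.trace_eq_one, ← RCLike.ofReal_sum] at this
    rw [e.sum_comp H.eigenvalues]
    exact Complex.ofReal_eq_one.1 this.symm
  · intro i
    have := sum_star_mul_of_isometry hWl (e i) (e i)
    rw [if_pos rfl] at this
    exact this
  · have hspec := H.spectral_theorem
    rw [Unitary.conjStarAlgAut_apply] at hspec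
    have : ρ = W * Matrix.diagonal (fun i => (H.eigenvalues i : ℂ)) * Wᴴ := hspec
    ext x y
    rw [Matrix.sum_apply, e.sum_comp (fun z => ((H.eigenvalues z : ℂ) •
      proj (fun x => W x z)) x y)]
    conv_lhs => rw [this, Matrix.mul_apply]
    refine Finset.sum_congr rfl fun i _ => ?_
    rw [Matrix.mul_diagonal, Matrix.conjTranspose_apply, Matrix.smul_apply, smul_eq_mul,
      proj_apply]
    ring

end Mixed

end CREN

theorem theorem3 (dA dB : ℕ) (hA : 2 ≤ dA) (hB : 2 ≤ dB) (l : ℕ) (α β : ℝ)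
    (ρ : CREN.BipMatrix dA dB) (hρ : CREN.IsState ρ) :
    CREN.cren ρ ≥
      (CREN.traceNorm (CREN.realignM l α β ρ)
          - Real.sqrt (((l : ℝ) * α ^ 2 + 1) * ((l : ℝ) * β ^ 2 + 1)))
        / (((min dA dB : ℕ) : ℝ) - 1) := by
  refine le_csInf (CREN.averageNegativities_nonempty hρ) ?_
  rintro _ ⟨n, p, φ, h, rfl⟩
  -- Gives a nonnegative denominator `d - 1`, so dividing by it preserves the inequality.
  have hd : (2 : ℝ) ≤ ((min dA dB : ℕ) : ℝ) := by exact_mod_cast le_min hA hB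
  simp only [CREN.pureNegativity, mul_div_assoc', ← Finset.sum_div]
  exact div_le_div_of_nonneg_right (CREN.traceNorm_realignM_le h) (by linarith)
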